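/- Let $d\ge 1$, let $\nu_1,\dots,\nu_d$ and $\nu_{\max}$ be Borel probability measures on $\mathbb{R}$, and for $i\in\mathbb{R}$ put $A^i=(-\infty,i]^d\subset\mathbb{R}^d$ and $\underline{\pi}^i=\overline{\pi}^i=\nu_{\max}((-\infty,i])$. Write $\max x=\max_{1\le j\le d}x_j$ for $x\in\mathbb{R}^d$. Let $\mathcal{Q}$ be the set of Borel probability measures $\mu$ on $\mathbb{R}^d$ with marginals $\nu_1,\dots,\nu_d$ and $\underline{\pi}^i\le\mu(A^i)\le\overline{\pi}^i$ for all $i\in\mathbb{R}$. For $f\colon\mathbb{R}^d\to\mathbb{R}$ let $$\phi(f)=\inf\Big\{\sum_{j=1}^d\int_{\mathbb{R}} f_j\,d\nu_j+\sum_{i\in\mathbb{R}}\big((a^i)^+\,\overline{\pi}^i-(a^i)^-\,\underline{\pi}^i\big)\Big\},$$ where the infimum, taken in $[-\infty,\infty]$, runs over all bounded Borel measurable $f_1,\dots,f_d\colon\mathbb{R}\to\mathbb{R}$ and all families $(a^i)_{i\in\mathbb{R}}$ of real numbers, with $a^i=0$ for all but finitely many $i$, such that $$f_1(x_1)+\dots+f_d(x_d)+\sum_{i\in\mathbb{R}}a^i\,1_{A^i}(x)\ge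 f(x)\quad\text{for all }x\in\mathbb{R}^d.$$ Then $\mathcal{Q}$ is the set of Borel probability measures $\mu$ on $\mathbb{R}^d$ with marginals $\nu_1,\dots,\nu_d$ such that $\mu\circ{\max}^{-1}=\nu_{\max}$. Moreover, for every bounded upper semicontinuous function $f\colon\mathbb{R}^d\to\mathbb{R}$, $$\phi(f)=\inf\Big\{\sum_{j=1}^d\int_{\mathbb{R}} f_j\,d\nu_j+\int_{\mathbb{R}} g\,d\nu_{\max}\Big\},$$ where the infimum, taken in $[-\infty,\infty]$, runs over all bounded Borel measurable $f_1,\dots,f_d,g\colon\mathbb{R}\to\mathbb{R}$ such that $$f_1(x_1)+\dots+f_d(x_d)+g(\max x)\ge f(x)\quad\text{for all }x\in\mathbb{R}^d.$$ -/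

import Mathlib

open MeasureTheory

noncomputable section

namespace MaxTransport

/-- A function with real values is bounded. -/
def IsBdd {X : Type*} (h : X → ℝ) : Prop := ∃ C : ℝ, ∀ x, |h x| ≤ C

/-- The set `(-∞, c 1] × ⋯ × (-∞, c d]`. -/
def lowerBox {d : ℕ} (c : Fin d → ℝ) : Set (Fin d → ℝ) :=
  Set.univ.pi fun j => Set.Iic (c j)

/-- The set `Θ(f)` of pairs `((f_1, …, f_d), a)` of bounded measurable functions `f_j` and a
finitely supported family `a` of reals such that
`f_1(x_1) + ⋯ + f_d(x_d) + ∑ a^i 1_{A^i}(x) ≥ f(x)` for all `x`, where `A^i` is the box with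
upper corner `A i`. -/
def Theta {d : ℕ} {I : Type*} (A : I → Fin d → ℝ) (f : (Fin d → ℝ) → ℝ) :
    Set ((Fin d → ℝ → ℝ) × (I →₀ ℝ)) :=
  {p | (∀ j, Measurable (p.1 j) ∧ IsBdd (p.1 j)) ∧
    ∀ x : Fin d → ℝ,
      f x ≤ ∑ j, p.1 j (x j)
        + p.2.sum fun i c => c * (lowerBox (A i)).indicator (fun _ => (1 : ℝ)) x}

/-- The cost `π(f_1, …, f_d, a)`, with lower and upper prices `lo i ≤ hi i` of `1_{A^i}`. -/
def price {d : ℕ} {I : Type*} (ν : Fin d → Measure ℝ) (lo hi : I → ℝ)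
    (p : (Fin d → ℝ → ℝ) × (I →₀ ℝ)) : ℝ :=
  ∑ j, ∫ t, p.1 j t ∂(ν j) + p.2.sum fun i c => max c 0 * hi i - max (-c) 0 * lo i

/-- The functional `φ(f) = inf {π(f_1, …, f_d, a) : (f_1, …, f_d, a) ∈ Θ(f)}`, an infimum in the
extended reals. -/
def phi {d : ℕ} {I : Type*} (ν : Fin d → Measure ℝ) (A : I → Fin d → ℝ) (lo hi : I → ℝ)
    (f : (Fin d → ℝ) → ℝ) : EReal :=
  ⨅ p ∈ Theta A f, ((price ν lo hi p : ℝ) : EReal)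

/-- The set `𝒬` of probability measures on `ℝ^d` with marginals `ν_1, …, ν_d` and with
`lo i ≤ μ(A^i) ≤ hi i` for all `i`. -/
def Q {d : ℕ} {I : Type*} (ν : Fin d → Measure ℝ) (A : I → Fin d → ℝ) (lo hi : I → ℝ) :
    Set (Measure (Fin d → ℝ)) :=
  {μ | IsProbabilityMeasure μ ∧ (∀ j, μ.map (fun x => x j) = ν j) ∧
    ∀ i, lo i ≤ μ.real (lowerBox (A i)) ∧ μ.real (lowerBox (A i)) ≤ hi i}

/-- The maximum `max_j x_j` of the coordinates of a vector. -/
def maxCoord {d : ℕ} [NeZero d] (x : Fin d → ℝ) : ℝ :=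
  Finset.univ.sup' Finset.univ_nonempty x

/-- The pairs `((f_1, …, f_d), g)` of bounded measurable functions such that
`f_1(x_1) + ⋯ + f_d(x_d) + g(max x) ≥ f(x)` for all `x`. -/
def ThetaMax {d : ℕ} [NeZero d] (f : (Fin d → ℝ) → ℝ) : Set ((Fin d → ℝ → ℝ) × (ℝ → ℝ)) :=
  {p | (∀ j, Measurable (p.1 j) ∧ IsBdd (p.1 j)) ∧ (Measurable p.2 ∧ IsBdd p.2) ∧
    ∀ x : Fin d → ℝ, f x ≤ ∑ j, p.1 j (x j) + p.2 (maxCoord x)}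

end MaxTransport

end

namespace MaxTransport

open Set Filter Topology

/-! Since `1_{A^i}(x) = 1_{(-∞, i]}(max x)` and both prices are `νmax (Iic i)`, `phi` is the second
infimum with `g` restricted to step functions. This gives `≥`, and half-lines determine a measure on
`ℝ`, which gives the description of `Q`.

For `≤`, a bounded Borel `g` must be traded for a step function at small cost. By
Vitali–Carathéodory, all the functions may be taken lower semicontinuous. Then `∑ G_j(x_j) + g(u) -
f(x)` is lower semicontinuous in `(x, u)` and nonnegative on the graph of `max`. Over a cube this
graph is compact, so the sum stays above `-ε` when `u` is near `max x` (`exists_radius`). Hence `g`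
may be replaced by its infima over short cells (`exists_stepFun_le`), a step function below `g`.
Outside the cube a large constant is added to the `G_j`; it costs little because the tails have
small mass. -/

/-- The step function `∑ a^i 1_{(-∞, i]}`. -/
noncomputable def stepFun (a : ℝ →₀ ℝ) (t : ℝ) : ℝ :=
  a.sum fun i c => c * (Set.Iic i).indicator (fun _ => (1 : ℝ)) t

theorem stepFun_add (a b : ℝ →₀ ℝ) (t : ℝ) : stepFun (a + b) t = stepFun a t + stepFun b t :=
  Finsupp.sum_add_index' (fun _ => zero_mul _) (fun _ _ _ => add_mul _ _ _)

theorem stepFun_single (i c t : ℝ) :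
    stepFun (Finsupp.single i c) t = c * (Set.Iic i).indicator (fun _ => (1 : ℝ)) t :=
  Finsupp.sum_single_index (zero_mul _)

theorem measurable_stepFun (a : ℝ →₀ ℝ) : Measurable (stepFun a) := by
  unfold stepFun Finsupp.sum
  exact Finset.measurable_sum _ fun i _ =>
    (measurable_const.indicator measurableSet_Iic).const_mul _

theorem isBdd_stepFun (a : ℝ →₀ ℝ) : IsBdd (stepFun a) := by
  refine ⟨∑ i ∈ a.support, |a i|, fun t => ?_⟩
  refine (Finset.abs_sum_le_sum_abs _ _).trans (Finset.sum_le_sum fun i _ => ?_)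
  by_cases h : t ∈ Set.Iic i <;> simp [h]

theorem IsBdd.integrable {h : ℝ → ℝ} (hb : IsBdd h) (hm : Measurable h) (μ : Measure ℝ)
    [IsFiniteMeasure μ] : Integrable h μ := by
  obtain ⟨C, hC⟩ := hb
  exact Integrable.of_bound hm.aestronglyMeasurable C (Eventually.of_forall hC)

theorem integral_stepFun (μ : Measure ℝ) [IsFiniteMeasure μ] (a : ℝ →₀ ℝ) :
    ∫ t, stepFun a t ∂μ = a.sum fun i c => c * μ.real (Set.Iic i) := by
  unfold stepFun Finsupp.sum
  rw [integral_finsetSum _ fun i _ =>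
    ((integrable_const (1 : ℝ)).indicator measurableSet_Iic).const_mul _]
  refine Finset.sum_congr rfl fun i _ => ?_
  rw [integral_const_mul, integral_indicator measurableSet_Iic]
  simp

theorem price_eq {d : ℕ} (ν : Fin d → Measure ℝ) (μ : Measure ℝ) [IsFiniteMeasure μ]
    (p : (Fin d → ℝ → ℝ) × (ℝ →₀ ℝ)) :
    price ν (fun i => μ.real (Set.Iic i)) (fun i => μ.real (Set.Iic i)) p
      = ∑ j, ∫ t, p.1 j t ∂(ν j) + ∫ t, stepFun p.2 t ∂μ := by
  rw [integral_stepFun, price]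
  congr 2
  funext i c
  rw [← sub_mul]
  congr 1
  rcases le_total c 0 with h | h
  · rw [max_eq_right h, max_eq_left (by linarith)]; ring
  · rw [max_eq_left h, max_eq_right (by linarith)]; ring

/-! ### The maximum and the boxes -/

theorem maxCoord_le_iff {d : ℕ} [NeZero d] (x : Fin d → ℝ) (c : ℝ) :
    maxCoord x ≤ c ↔ ∀ j, x j ≤ c := by
  simp [maxCoord, Finset.sup'_le_iff]

theorem continuous_maxCoord {d : ℕ} [NeZero d] :
    Continuous (maxCoord : (Fin d → ℝ) → ℝ) :=
  Continuous.finset_sup'_apply _ fun j _ => continuous_apply j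

theorem lowerBox_const {d : ℕ} [NeZero d] (i : ℝ) :
    lowerBox (fun _ : Fin d => i) = maxCoord ⁻¹' Set.Iic i := by
  ext x
  simp [lowerBox, maxCoord_le_iff, Pi.le_def]

theorem sum_indicator_lowerBox {d : ℕ} [NeZero d] (a : ℝ →₀ ℝ) (x : Fin d → ℝ) :
    (a.sum fun i c => c * (lowerBox (fun _ : Fin d => i)).indicator (fun _ => (1 : ℝ)) x)
      = stepFun a (maxCoord x) := by
  simp only [lowerBox_const]
  rfl

/-! ### Semicontinuous majorants and step minorants -/

/-- A bounded measurable function has bounded lower semicontinuous majorants with almost the same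
integral. -/
theorem exists_lowerSemicontinuous_ge (μ : Measure ℝ) [IsFiniteMeasure μ] {g : ℝ → ℝ}
    (hm : Measurable g) (hb : IsBdd g) {ε : ℝ} (hε : 0 < ε) :
    ∃ G : ℝ → ℝ, LowerSemicontinuous G ∧ IsBdd G ∧ (∀ t, g t ≤ G t) ∧
      ∫ t, G t ∂μ ≤ ∫ t, g t ∂μ + ε := by
  -- `H` may be unbounded or infinite; capping it at the bound `C` of `|g|` keeps it above `g` and
  -- lower semicontinuous.
  obtain ⟨H, hgH, hH, hHi, hHtop, hint⟩ :=
    exists_lt_lowerSemicontinuous_integral_lt g (hb.integrable hm μ) hε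
  obtain ⟨C, hC⟩ := hb
  have hcoe : ∀ t, (((min (H t) C).toReal : ℝ) : EReal) = min (H t) C := fun t =>
    EReal.coe_toReal (ne_top_of_le_ne_top (EReal.coe_ne_top C) (min_le_right _ _))
      (ne_of_gt (lt_min ((EReal.bot_lt_coe _).trans (hgH t)) (EReal.bot_lt_coe C)))
  have hge : ∀ t, g t ≤ (min (H t) C).toReal := fun t => by
    rw [← EReal.coe_le_coe_iff, hcoe]
    exact le_min (hgH t).le (EReal.coe_le_coe_iff.2 (le_of_abs_le (hC t)))
  have hlsc : LowerSemicontinuous fun t => (min (H t) C).toReal := by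
    intro t y hy
    have hy : y < (min (H t) C).toReal := hy
    rw [← EReal.coe_lt_coe_iff, hcoe, lt_min_iff] at hy
    filter_upwards [hH t _ hy.1] with s hs
    show y < (min (H s) C).toReal
    rw [← EReal.coe_lt_coe_iff, hcoe]
    exact lt_min hs hy.2
  have hbdd : IsBdd fun t => (min (H t) C).toReal := by
    refine ⟨C, fun t => abs_le.2 ⟨(neg_le_of_abs_le (hC t)).trans (hge t), ?_⟩⟩
    rw [← EReal.coe_le_coe_iff, hcoe]
    exact min_le_right _ _
  refine ⟨_, hlsc, hbdd, hge, le_trans ?_ hint.le⟩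
  refine integral_mono_ae (hbdd.integrable hlsc.measurable μ) hHi ?_
  filter_upwards [hHtop] with t ht
  rw [← EReal.coe_le_coe_iff, hcoe,
    EReal.coe_toReal ht.ne (ne_of_gt ((EReal.bot_lt_coe _).trans (hgH t)))]
  exact min_le_left _ _

/-- Below a function bounded from below there is a step function supported on `(s, s + n η]` which
there dominates the infima over intervals of radius `η`. -/
theorem exists_stepFun_le (g : ℝ → ℝ) (hg : BddBelow (range g)) (s : ℝ) {η : ℝ} (hη : 0 < η)
    (n : ℕ) :
    ∃ a : ℝ →₀ ℝ, (∀ t ∉ Ioc s (s + n * η), stepFun a t = 0) ∧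
      ∀ t ∈ Ioc s (s + n * η), stepFun a t ≤ g t ∧
        ∀ r, (∀ u, |u - t| < η → r ≤ g u) → r ≤ stepFun a t := by
  induction n with
  | zero => exact ⟨0, fun t _ => by simp [stepFun], fun t ht => by simp at ht⟩
  | succ n ih =>
    obtain ⟨a, ha0, ha⟩ := ih
    set m := s + n * η with hm
    have hm' : s + (n + 1 : ℕ) * η = m + η := by push_cast; ring
    have hsm : s ≤ m := by have : (0 : ℝ) ≤ n * η := by positivity
                           linarith
    set c := sInf (g '' Ioc m (m + η)) with hc
    -- The two coefficients cancel up to `m`, leaving `c` on the new cell only.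
    have key : ∀ t, stepFun (a + (Finsupp.single (m + η) c + Finsupp.single m (-c))) t
        = stepFun a t + (Ioc m (m + η)).indicator (fun _ => c) t := by
      intro t
      rw [stepFun_add, stepFun_add, stepFun_single, stepFun_single]
      congr 1
      by_cases h1 : t ≤ m
      · have h2 : t ≤ m + η := by linarith
        simp [indicator, h1, h2, not_lt.2 h1]
      · by_cases h2 : t ≤ m + η <;> simp [indicator, h1, h2, not_le.1 h1]
    refine ⟨a + (Finsupp.single (m + η) c + Finsupp.single m (-c)),
      fun t ht => ?_, fun t ht => ?_⟩
    · rw [hm'] at ht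
      rw [key, ha0 t fun h => ht ⟨h.1, by linarith [h.2]⟩, indicator_of_notMem, add_zero]
      exact fun h => ht ⟨by linarith [h.1], h.2⟩
    · rw [hm'] at ht
      rw [key]
      by_cases h : t ≤ m
      · rw [indicator_of_notMem fun h' => absurd h'.1 (not_lt.2 h), add_zero]
        exact ha t ⟨ht.1, h⟩
      · have htc : t ∈ Ioc m (m + η) := ⟨not_le.1 h, ht.2⟩
        rw [ha0 t fun h' => h h'.2, indicator_of_mem htc, zero_add]
        refine ⟨csInf_le (hg.mono (image_subset_range _ _)) (mem_image_of_mem _ htc),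
          fun r hr => le_csInf ⟨_, mem_image_of_mem _ htc⟩ ?_⟩
        rintro _ ⟨u, hu, rfl⟩
        -- Two points of one half-open cell of length `η` are at distance strictly less than `η`.
        exact hr u (abs_sub_lt_iff.2 ⟨by linarith [hu.2, htc.1], by linarith [hu.1, htc.2]⟩)

theorem tendsto_measureReal_compl_Ioc (μ : Measure ℝ) [IsFiniteMeasure μ] :
    Tendsto (fun N : ℕ => μ.real (Ioc (-N : ℝ) N)ᶜ) atTop (𝓝 0) := by
  have h := tendsto_measure_iInter_atTop (μ := μ) (s := fun N : ℕ => (Ioc (-N : ℝ) N)ᶜ)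
    (fun N => measurableSet_Ioc.compl.nullMeasurableSet)
    (fun N M h => compl_subset_compl.2
      (Ioc_subset_Ioc (neg_le_neg (Nat.cast_le.2 h)) (Nat.cast_le.2 h)))
    ⟨0, measure_ne_top _ _⟩
  have he : (⋂ N : ℕ, (Ioc (-N : ℝ) N)ᶜ) = ∅ := by
    rw [← compl_iUnion, compl_empty_iff, eq_univ_iff_forall]
    intro t
    obtain ⟨N, hN⟩ := exists_nat_gt |t|
    exact mem_iUnion.2 ⟨N, (abs_lt.1 hN).1, (abs_lt.1 hN).2.le⟩
  rw [he, measure_empty] at h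
  exact (ENNReal.tendsto_toReal ENNReal.zero_ne_top).comp h

/-! ### Replacing `g` by a step function -/

/-- If lower semicontinuous functions satisfy `f x ≤ ∑ G_j(x_j) + g(max x)`, then on a cube the
inequality persists, up to a small error, under small perturbations of the argument of `g`. -/
theorem exists_radius {d : ℕ} [NeZero d] {f : (Fin d → ℝ) → ℝ} (hf : UpperSemicontinuous f)
    {G : Fin d → ℝ → ℝ} (hG : ∀ j, LowerSemicontinuous (G j)) {g : ℝ → ℝ}
    (hg : LowerSemicontinuous g) (hle : ∀ x, f x ≤ ∑ j, G j (x j) + g (maxCoord x))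
    (N : ℝ) {ε : ℝ} (hε : 0 < ε) :
    ∃ δ > 0, ∀ x : Fin d → ℝ, (∀ j, x j ∈ Icc (-N) N) → ∀ u, |u - maxCoord x| < δ →
      f x - ε ≤ ∑ j, G j (x j) + g u := by
  have hlsc : LowerSemicontinuous fun q : (Fin d → ℝ) × ℝ =>
      (∑ j, G j (q.1 j) + g q.2) + -f q.1 := by
    refine LowerSemicontinuous.add (LowerSemicontinuous.add ?_ ?_) ?_
    · exact lowerSemicontinuous_sum fun j _ => (hG j).comp (by fun_prop)
    · exact hg.comp continuous_snd
    · intro q y hy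
      filter_upwards [(hf.comp continuous_fst) q (-y) (by simpa using (lt_neg.1 hy))] with z hz
      exact lt_neg.1 hz
  have hK : IsCompact ((fun x : Fin d → ℝ => (x, maxCoord x)) ''
      Set.univ.pi fun _ => Icc (-N) N) :=
    (isCompact_univ_pi fun _ => isCompact_Icc).image
      (continuous_id.prodMk continuous_maxCoord)
  obtain ⟨δ, hδ, hsub⟩ := hK.exists_thickening_subset_open (hlsc.isOpen_preimage (-ε)) (by
    rintro _ ⟨x, -, rfl⟩
    have := hle x
    simp only [mem_preimage, mem_Ioi]
    linarith)
  refine ⟨δ, hδ, fun x hx u hu => ?_⟩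
  have : (x, u) ∈ Metric.thickening δ ((fun x : Fin d → ℝ => (x, maxCoord x)) ''
      Set.univ.pi fun _ => Icc (-N) N) := by
    refine Metric.mem_thickening_iff.2 ⟨_, mem_image_of_mem _ fun j _ => hx j, ?_⟩
    rw [Prod.dist_eq]
    simpa [Real.dist_eq] using hu
  have := hsub this
  simp only [mem_preimage, mem_Ioi] at this
  linarith

theorem exists_mem_Theta_of_lowerSemicontinuous {d : ℕ} [NeZero d] (ν : Fin d → Measure ℝ)
    [∀ j, IsProbabilityMeasure (ν j)] (μ : Measure ℝ) [IsProbabilityMeasure μ]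
    {f : (Fin d → ℝ) → ℝ} (hf : UpperSemicontinuous f) (hfb : IsBdd f)
    {G : Fin d → ℝ → ℝ} (hG : ∀ j, LowerSemicontinuous (G j)) (hGb : ∀ j, IsBdd (G j))
    {g : ℝ → ℝ} (hg : LowerSemicontinuous g) (hgb : IsBdd g)
    (hle : ∀ x, f x ≤ ∑ j, G j (x j) + g (maxCoord x)) {ε : ℝ} (hε : 0 < ε) :
    ∃ q ∈ Theta (fun (i : ℝ) (_ : Fin d) => i) f,
      ∑ j, ∫ t, q.1 j t ∂(ν j) + ∫ t, stepFun q.2 t ∂μ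
        ≤ ∑ j, ∫ t, G j t ∂(ν j) + ∫ t, g t ∂μ + ε := by
  have hgi := hgb.integrable hg.measurable μ
  have hGi := fun j => (hGb j).integrable (hG j).measurable (ν j)
  obtain ⟨Bf, hBf⟩ := hfb
  choose B hB using hGb
  obtain ⟨Bg, hBg⟩ := hgb
  have hBf0 : 0 ≤ Bf := (abs_nonneg _).trans (hBf 0)
  have hB0 : ∀ j, 0 ≤ B j := fun j => (abs_nonneg _).trans (hB j 0)
  have hBg0 : 0 ≤ Bg := (abs_nonneg _).trans (hBg 0)
  have hBs : 0 ≤ ∑ j, B j := Finset.sum_nonneg fun j _ => hB0 j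
  -- One penalty `C` makes the constraint hold off the cube, whatever the values of `f`, the `G_j`
  -- and the step function there.
  set C := Bf + ∑ j, B j + Bg with hC
  have hd : (0 : ℝ) < d := Nat.cast_pos.2 (NeZero.pos d)
  obtain ⟨N, hN⟩ : ∃ N : ℕ, ∑ j, C * (ν j).real (Ioc (-N : ℝ) N)ᶜ
      + C * μ.real (Ioc (-N : ℝ) N)ᶜ < ε / 2 := by
    have h : Tendsto (fun N : ℕ => ∑ j, C * (ν j).real (Ioc (-N : ℝ) N)ᶜ
        + C * μ.real (Ioc (-N : ℝ) N)ᶜ) atTop (𝓝 (∑ _j : Fin d, C * 0 + C * 0)) :=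
      (tendsto_finsetSum _ fun j _ => (tendsto_measureReal_compl_Ioc (ν j)).const_mul C).add
        ((tendsto_measureReal_compl_Ioc μ).const_mul C)
    simp only [mul_zero, Finset.sum_const_zero, add_zero] at h
    exact (h.eventually_lt_const (half_pos hε)).exists
  set T := Ioc (-N : ℝ) N with hT
  obtain ⟨δ, hδ, hrad⟩ := exists_radius hf hG hg hle N (half_pos hε)
  obtain ⟨n, hn⟩ := exists_nat_gt (2 * N / δ)
  -- The cells must tile `(-N, N]` exactly; for `N = 0` the window is empty and no cell is needed.
  obtain ⟨η, hη, hηδ, k, hk⟩ : ∃ η > 0, η ≤ δ ∧ ∃ k : ℕ, (-N : ℝ) + k * η = N := by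
    rcases Nat.eq_zero_or_pos N with rfl | hN0
    · exact ⟨δ, hδ, le_rfl, 0, by simp⟩
    · have hN0 : (0 : ℝ) < N := Nat.cast_pos.2 hN0
      have hn0 : (0 : ℝ) < n := lt_trans (by positivity) hn
      refine ⟨2 * N / n, by positivity, ?_, n, by field_simp; ring⟩
      rw [div_lt_iff₀ hδ] at hn
      rw [div_le_iff₀ hn0]
      linarith
  obtain ⟨a, ha0, ha⟩ := exists_stepFun_le g
    ⟨-Bg, by rintro _ ⟨t, rfl⟩; exact neg_le_of_abs_le (hBg t)⟩ (-N) hη k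
  rw [hk] at ha0 ha
  have haB : ∀ t, -Bg ≤ stepFun a t := fun t => by
    by_cases ht : t ∈ T
    · exact (ha t ht).2 _ fun u _ => neg_le_of_abs_le (hBg u)
    · rw [ha0 t ht]; linarith
  have hind : ∀ t, 0 ≤ Tᶜ.indicator (fun _ => C) t := fun t =>
    indicator_nonneg (fun _ _ => by positivity) t
  have hTi : ∀ (ρ : Measure ℝ) [IsProbabilityMeasure ρ],
      Integrable (Tᶜ.indicator fun _ => C) ρ := fun ρ _ =>
    (integrable_const C).indicator measurableSet_Ioc.compl
  have hTint : ∀ (ρ : Measure ℝ) [IsProbabilityMeasure ρ],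
      ∫ t, Tᶜ.indicator (fun _ => C) t ∂ρ = C * ρ.real Tᶜ := fun ρ _ => by
    rw [integral_indicator measurableSet_Ioc.compl]
    simp [mul_comm, hT]
  -- The constants add up to the `ε / 2` lost in `exists_radius`; the indicators pay for the points
  -- off the cube, and with the tail of `μ` cost less than `ε / 2`.
  refine ⟨(fun j t => G j t + (ε / 2 / d + Tᶜ.indicator (fun _ => C) t), a),
    ⟨fun j => ⟨?_, ?_⟩, fun x => ?_⟩, ?_⟩
  · exact (hG j).measurable.add
      (measurable_const.add (measurable_const.indicator measurableSet_Ioc.compl))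
  · refine ⟨B j + (ε / 2 / d + C), fun t => (abs_add_le _ _).trans (add_le_add (hB j t) ?_)⟩
    rw [abs_of_nonneg (add_nonneg (by positivity) (hind t))]
    gcongr
    exact indicator_le_self' (fun _ _ => by positivity) t
  · rw [sum_indicator_lowerBox]
    simp only [Finset.sum_add_distrib, Finset.sum_const, Finset.card_univ, Fintype.card_fin,
      nsmul_eq_mul, mul_div_cancel₀ _ hd.ne']
    by_cases hx : ∀ j, x j ∈ T
    · have hmax : maxCoord x ∈ T := by
        refine ⟨?_, (maxCoord_le_iff x _).2 fun j => (hx j).2⟩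
        exact (hx 0).1.trans_le ((maxCoord_le_iff x _).1 le_rfl 0)
      have h1 := (ha _ hmax).2 (f x - ε / 2 - ∑ j, G j (x j)) fun u hu => by
        have := hrad x (fun j => Ioc_subset_Icc_self (hx j)) u (hu.trans_le hηδ)
        linarith
      have h2 : 0 ≤ ∑ j, Tᶜ.indicator (fun _ => C) (x j) :=
        Finset.sum_nonneg fun j _ => hind _
      linarith
    · push Not at hx
      obtain ⟨j, hj⟩ := hx
      have h1 : C ≤ ∑ j, Tᶜ.indicator (fun _ => C) (x j) := by
        have := Finset.single_le_sum (f := fun j => Tᶜ.indicator (fun _ => C) (x j))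
          (fun j _ => hind _) (Finset.mem_univ j)
        simpa only [indicator_of_mem (show x j ∈ Tᶜ from hj)] using this
      have h2 : -∑ j, B j ≤ ∑ j, G j (x j) := by
        rw [← Finset.sum_neg_distrib]
        exact Finset.sum_le_sum fun j _ => neg_le_of_abs_le (hB j _)
      have h3 := le_of_abs_le (hBf x)
      have h4 := haB (maxCoord x)
      linarith
  -- Off `T` the step function is `0`, which can exceed `g` by at most `Bg ≤ C`.
  · have h1 : ∫ t, stepFun a t ∂μ ≤ ∫ t, g t ∂μ + C * μ.real Tᶜ := by
      rw [← hTint, ← integral_add hgi (hTi μ)]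
      refine integral_mono ((isBdd_stepFun a).integrable (measurable_stepFun a) μ)
        (hgi.add (hTi μ)) fun t => ?_
      by_cases ht : t ∈ T
      · exact (ha t ht).1.trans (le_add_of_nonneg_right (hind t))
      · have := neg_le_of_abs_le (hBg t)
        simp only [ha0 t ht, indicator_of_mem (show t ∈ Tᶜ from ht)]
        linarith
    have h2 : ∀ j, ∫ t, (G j t + (ε / 2 / d + Tᶜ.indicator (fun _ => C) t)) ∂(ν j)
        = ∫ t, G j t ∂(ν j) + (ε / 2 / d + C * (ν j).real Tᶜ) := fun j => by
      have h3 : Integrable (fun t => ε / 2 / d + Tᶜ.indicator (fun _ => C) t) (ν j) :=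
        (integrable_const _).add (hTi (ν j))
      rw [integral_add (hGi j) h3,
        integral_add (integrable_const _) (hTi (ν j)), hTint]
      simp
    simp only [h2, Finset.sum_add_distrib, Finset.sum_const, Finset.card_univ, Fintype.card_fin,
      nsmul_eq_mul, mul_div_cancel₀ _ hd.ne']
    linarith

theorem exists_mem_Theta_le {d : ℕ} [NeZero d] (ν : Fin d → Measure ℝ)
    [∀ j, IsProbabilityMeasure (ν j)] (μ : Measure ℝ) [IsProbabilityMeasure μ]
    {f : (Fin d → ℝ) → ℝ} (hf : UpperSemicontinuous f) (hfb : IsBdd f)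
    {p : (Fin d → ℝ → ℝ) × (ℝ → ℝ)} (hp : p ∈ ThetaMax f) {ε : ℝ} (hε : 0 < ε) :
    ∃ q ∈ Theta (fun (i : ℝ) (_ : Fin d) => i) f,
      ∑ j, ∫ t, q.1 j t ∂(ν j) + ∫ t, stepFun q.2 t ∂μ
        ≤ ∑ j, ∫ t, p.1 j t ∂(ν j) + ∫ t, p.2 t ∂μ + ε := by
  obtain ⟨hp1, ⟨hp2, hp2b⟩, hle⟩ := hp
  have hd : (0 : ℝ) < d := Nat.cast_pos.2 (NeZero.pos d)
  choose G hG hGb hpG hGint using fun j =>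
    exists_lowerSemicontinuous_ge (ν j) (hp1 j).1 (hp1 j).2 (show 0 < ε / 3 / d by positivity)
  obtain ⟨g, hg, hgb, hpg, hgint⟩ :=
    exists_lowerSemicontinuous_ge μ hp2 hp2b (show 0 < ε / 3 by positivity)
  obtain ⟨q, hq, hqle⟩ := exists_mem_Theta_of_lowerSemicontinuous ν μ hf hfb hG hGb hg hgb
    (fun x => (hle x).trans (add_le_add (Finset.sum_le_sum fun j _ => hpG j _) (hpg _)))
    (show 0 < ε / 3 by positivity)
  refine ⟨q, hq, hqle.trans ?_⟩
  have h := Finset.sum_le_sum fun j (_ : j ∈ Finset.univ) => hGint j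
  simp only [Finset.sum_add_distrib, Finset.sum_const, Finset.card_univ, Fintype.card_fin,
    nsmul_eq_mul, mul_div_cancel₀ _ hd.ne'] at h
  linarith

/-! ### The law of the maximum -/

theorem map_maxCoord_eq_iff {d : ℕ} [NeZero d] (μ : Measure (Fin d → ℝ)) [IsFiniteMeasure μ]
    (ρ : Measure ℝ) [IsFiniteMeasure ρ] :
    μ.map maxCoord = ρ ↔ ∀ i, μ.real (lowerBox fun _ => i) = ρ.real (Set.Iic i) := by
  have hm : Measurable (maxCoord : (Fin d → ℝ) → ℝ) := continuous_maxCoord.measurable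
  have h : ∀ i, μ.real (lowerBox fun _ => i) = (μ.map maxCoord).real (Set.Iic i) := fun i => by
    rw [lowerBox_const, map_measureReal_apply hm measurableSet_Iic]
  refine ⟨fun e i => by rw [h, e], fun e => Measure.ext_of_Iic _ _ fun i => ?_⟩
  have := e i
  rw [h] at this
  exact (measureReal_eq_measureReal_iff (measure_ne_top _ _) (measure_ne_top _ _)).1 this

end MaxTransport

theorem mainTheorem6 (d : ℕ) [NeZero d] (ν : Fin d → Measure ℝ)
    [∀ j, IsProbabilityMeasure (ν j)] (νmax : Measure ℝ) [IsProbabilityMeasure νmax] :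
    MaxTransport.Q ν (fun (i : ℝ) (_ : Fin d) => i)
        (fun i => νmax.real (Set.Iic i)) (fun i => νmax.real (Set.Iic i))
      = {μ : Measure (Fin d → ℝ) | IsProbabilityMeasure μ ∧
          (∀ j, μ.map (fun x => x j) = ν j) ∧ μ.map MaxTransport.maxCoord = νmax} ∧
    ∀ f : (Fin d → ℝ) → ℝ, UpperSemicontinuous f → MaxTransport.IsBdd f →
      MaxTransport.phi ν (fun (i : ℝ) (_ : Fin d) => i)
          (fun i => νmax.real (Set.Iic i)) (fun i => νmax.real (Set.Iic i)) f
        = ⨅ p ∈ MaxTransport.ThetaMax f,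
            ((∑ j, ∫ t, p.1 j t ∂(ν j) + ∫ t, p.2 t ∂νmax : ℝ) : EReal) := by

  open MaxTransport in
  constructor
  · ext μ
    refine and_congr_right fun _ => and_congr_right fun _ => ?_
    rw [map_maxCoord_eq_iff]
    exact forall_congr' fun i => ⟨fun h => le_antisymm h.2 h.1, fun h => ⟨h.ge, h.le⟩⟩
  · intro f hf hfb
    refine le_antisymm (le_iInf₂ fun p hp => ?_) (le_iInf₂ fun q hq => ?_)
    -- Testing against reals `z` above the cost of `p` makes the gap the allowed error.
    · refine EReal.le_of_forall_lt_iff_le.1 fun z hz => ?_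
      obtain ⟨q, hq, hle⟩ := exists_mem_Theta_le ν νmax hf hfb hp
        (sub_pos.2 (EReal.coe_lt_coe_iff.1 hz))
      refine (iInf₂_le q hq).trans (EReal.coe_le_coe_iff.2 ?_)
      rw [price_eq]
      linarith
    · rw [price_eq]
      refine iInf₂_le (f := fun (p : (Fin d → ℝ → ℝ) × (ℝ → ℝ)) (_ : p ∈ ThetaMax f) =>
        ((∑ j, ∫ t, p.1 j t ∂(ν j) + ∫ t, p.2 t ∂νmax : ℝ) : EReal)) (q.1, stepFun q.2)
        ⟨hq.1, ⟨measurable_stepFun _, isBdd_stepFun _⟩, fun x => ?_⟩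
      exact (hq.2 x).trans_eq (congrArg _ (sum_indicator_lowerBox q.2 x))
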